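/- Let $n\ge 1$ and let $L_0,L_1,L_2,M\in\mathbb R^{n\times n}$, where $L_0$ and $L_2$ are symmetric, $L_1$ is skew-symmetric, $M$ is symmetric positive definite, and $L_2$ is nonsingular. Define the $2n\times 2n$ matrices $$\widetilde L_2=\begin{bmatrix}L_2&0\\0&L_2\end{bmatrix},\quad \widetilde L_1=\begin{bmatrix}L_1&0\\2L_2&L_1\end{bmatrix},\quad \widetilde L_0=\begin{bmatrix}L_0&0\\L_1&L_0\end{bmatrix},\quad \widetilde M=\begin{bmatrix}M&0\\0&M\end{bmatrix}$$ and the $2\times 2$ matrices $$C_2=\begin{bmatrix}1&0\\0&0\end{bmatrix},\quad C_1=\begin{bmatrix}0&-1\\-1&0\end{bmatrix},\quad C_0=\begin{bmatrix}0&0\\0&1\end{bmatrix},$$ and the $4n^2\times 4n^2$ matrices $$\Delta_0=\begin{vmatrix}L_2&L_1&M\\ \widetilde L_2&\widetilde L_1&\widetilde M\\ C_2&C_1&0\end{vmatrix}_\otimes,\qquad \Delta_1=-\begin{vmatrix}L_2&L_0&M\\ \widetilde L_2&\widetilde L_0&\widetilde M\\ C_2&C_0&0\end{vmatrix}_\otimes,$$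 where $|\cdot|_\otimes$ denotes the Leibniz expansion of the $3\times3$ determinant in which the products of the entries (taken in the order of the rows) are Kronecker products. Let $k,\omega\in\mathbb C$, and suppose that there are vectors $u,u'\in\mathbb C^n$ with $u\neq 0$ such that $$\bigl[(\mathrm ik)^2L_2+\mathrm ik\,L_1+L_0+\omega^2M\bigr]u=0\quad\text{and}\quad \bigl[(\mathrm ik)^2\widetilde L_2+\mathrm ik\,\widetilde L_1+\widetilde L_0+\omega^2\widetilde M\bigr]\begin{bmatrix}u\\u'\end{bmatrix}=0 .$$ Then the pencil $\Delta_1-\xi\Delta_0$ is singular, i.e. $\det(\Delta_1-\xi\Delta_0)=0$ for all $\xi\in\mathbb C$, and $\lambda=\mathrm ik$ is a finite eigenvalue of it, i.e. $$\operatorname{rank}(\Delta_1-\mathrm ik\,\Delta_0)<\max_{\xi\in\mathbb C}\operatorname{rank}(\Delta_1-\xi\Delta_0).$$ -/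

import Mathlib

open scoped Kronecker

namespace ZGV

/-- The entrywise complexification of a real matrix. -/
noncomputable def cx {m : Type*} (A : Matrix m m ℝ) : Matrix m m ℂ :=
  A.map (fun x : ℝ => (x : ℂ))

/-- The discrete waveguide operator
`W(k, ω) = (i k)² L₂ + (i k) L₁ + L₀ + ω² M`. -/
noncomputable def waveguideOp {n : ℕ} (L₀ L₁ L₂ M : Matrix (Fin n) (Fin n) ℝ) (k ω : ℂ) :
    Matrix (Fin n) (Fin n) ℂ :=
  (Complex.I * k) ^ 2 • cx L₂ + (Complex.I * k) • cx L₁ + cx L₀ + ω ^ 2 • cx M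

/-- `L̃₂ = [L₂, 0; 0, L₂]`. -/
def tildeL₂ {n : ℕ} (L₂ : Matrix (Fin n) (Fin n) ℝ) :
    Matrix (Fin n ⊕ Fin n) (Fin n ⊕ Fin n) ℝ :=
  Matrix.fromBlocks L₂ 0 0 L₂

/-- `L̃₁ = [L₁, 0; 2 L₂, L₁]`. -/
def tildeL₁ {n : ℕ} (L₁ L₂ : Matrix (Fin n) (Fin n) ℝ) :
    Matrix (Fin n ⊕ Fin n) (Fin n ⊕ Fin n) ℝ :=
  Matrix.fromBlocks L₁ 0 ((2 : ℝ) • L₂) L₁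

/-- `L̃₀ = [L₀, 0; L₁, L₀]`. -/
def tildeL₀ {n : ℕ} (L₀ L₁ : Matrix (Fin n) (Fin n) ℝ) :
    Matrix (Fin n ⊕ Fin n) (Fin n ⊕ Fin n) ℝ :=
  Matrix.fromBlocks L₀ 0 L₁ L₀

/-- `M̃ = [M, 0; 0, M]`. -/
def tildeM {n : ℕ} (M : Matrix (Fin n) (Fin n) ℝ) :
    Matrix (Fin n ⊕ Fin n) (Fin n ⊕ Fin n) ℝ :=
  Matrix.fromBlocks M 0 0 M

/-- The `2n × 2n` matrix of the exceptional mode equation,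
`(i k)² L̃₂ + (i k) L̃₁ + L̃₀ + ω² M̃`. -/
noncomputable def exceptionalOp {n : ℕ} (L₀ L₁ L₂ M : Matrix (Fin n) (Fin n) ℝ) (k ω : ℂ) :
    Matrix (Fin n ⊕ Fin n) (Fin n ⊕ Fin n) ℂ :=
  (Complex.I * k) ^ 2 • cx (tildeL₂ L₂) + (Complex.I * k) • cx (tildeL₁ L₁ L₂)
    + cx (tildeL₀ L₀ L₁) + ω ^ 2 • cx (tildeM M)

/-- `(i k, ω)` solves the waveguide problem and the exceptional mode equation: there are a nonzero
vector `u` with `W(k, ω) u = 0` and a vector `u'` such that `ũ = [u; u']` is annihilated by the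
`2n × 2n` matrix of the exceptional mode equation. -/
def IsZGVSolution {n : ℕ} (L₀ L₁ L₂ M : Matrix (Fin n) (Fin n) ℝ) (k ω : ℂ) : Prop :=
  ∃ u u' : Fin n → ℂ, u ≠ 0 ∧
    (waveguideOp L₀ L₁ L₂ M k ω).mulVec u = 0 ∧
    (exceptionalOp L₀ L₁ L₂ M k ω).mulVec (Sum.elim u u') = 0

/-- `C₂ = [1, 0; 0, 0]`. -/
def C₂ : Matrix (Fin 2) (Fin 2) ℝ := !![1, 0; 0, 0]

/-- `C₁ = [0, -1; -1, 0]`. -/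
def C₁ : Matrix (Fin 2) (Fin 2) ℝ := !![0, -1; -1, 0]

/-- `C₀ = [0, 0; 0, 1]`. -/
def C₀ : Matrix (Fin 2) (Fin 2) ℝ := !![0, 0; 0, 1]

/-- The operator determinant of a `3 × 3` array of square matrices, whose three rows consist of
matrices of sizes `p`, `q`, `r`: the Leibniz expansion of the determinant with Kronecker products,
taken in the order of the rows, in place of products. -/
def opDet {p q r : Type*}
    (A₁ A₂ A₃ : Matrix p p ℝ) (B₁ B₂ B₃ : Matrix q q ℝ) (D₁ D₂ D₃ : Matrix r r ℝ) :
    Matrix (p × q × r) (p × q × r) ℝ :=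
  A₁ ⊗ₖ (B₂ ⊗ₖ D₃) + A₂ ⊗ₖ (B₃ ⊗ₖ D₁) + A₃ ⊗ₖ (B₁ ⊗ₖ D₂)
    - A₃ ⊗ₖ (B₂ ⊗ₖ D₁) - A₂ ⊗ₖ (B₁ ⊗ₖ D₃) - A₁ ⊗ₖ (B₃ ⊗ₖ D₂)

/-- `Δ₀ = |L₂, L₁, M; L̃₂, L̃₁, M̃; C₂, C₁, 0|_⊗`, of size `n · 2n · 2 = 4n²`. -/
def Δ₀ {n : ℕ} (L₁ L₂ M : Matrix (Fin n) (Fin n) ℝ) :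
    Matrix (Fin n × (Fin n ⊕ Fin n) × Fin 2) (Fin n × (Fin n ⊕ Fin n) × Fin 2) ℝ :=
  opDet L₂ L₁ M
    (tildeL₂ L₂) (tildeL₁ L₁ L₂) (tildeM M)
    C₂ C₁ 0

/-- `Δ₁ = - |L₂, L₀, M; L̃₂, L̃₀, M̃; C₂, C₀, 0|_⊗`, of size `n · 2n · 2 = 4n²`. -/
def Δ₁ {n : ℕ} (L₀ L₁ L₂ M : Matrix (Fin n) (Fin n) ℝ) :
    Matrix (Fin n × (Fin n ⊕ Fin n) × Fin 2) (Fin n × (Fin n ⊕ Fin n) × Fin 2) ℝ :=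
  -opDet L₂ L₀ M
    (tildeL₂ L₂) (tildeL₀ L₀ L₁) (tildeM M)
    C₂ C₀ 0

/-- The normal rank of the pencil `A - ξ B`: the largest rank of `A - ξ B` over `ξ ∈ ℂ`. -/
noncomputable def normalRank {m : Type*} [Fintype m] (A B : Matrix m m ℂ) : ℕ :=
  ⨆ ξ : ℂ, (A - ξ • B).rank

/-- The supremum in `normalRank` is a maximum. -/
theorem isGreatest_normalRank {m : Type*} [Fintype m] (A B : Matrix m m ℂ) :
    IsGreatest (Set.range fun ξ : ℂ => (A - ξ • B).rank) (normalRank A B) := by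
  have hb : BddAbove (Set.range fun ξ : ℂ => (A - ξ • B).rank) :=
    ⟨Fintype.card m, by rintro _ ⟨ξ, rfl⟩; exact Matrix.rank_le_card_width _⟩
  exact ⟨Nat.sSup_mem (Set.range_nonempty _) hb, fun _ hx => le_csSup hb hx⟩

/-- The pencil `A - ξ B` is singular: `det (A - ξ B)` vanishes for every `ξ ∈ ℂ`. -/
def IsSingularPencil {m : Type*} [Fintype m] [DecidableEq m] (A B : Matrix m m ℂ) : Prop :=
  ∀ ξ : ℂ, (A - ξ • B).det = 0

/-- `l` is a finite eigenvalue of the pencil `A - ξ B`: the rank drops below the normal rank. -/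
def IsFiniteEigenvalue {m : Type*} [Fintype m] (A B : Matrix m m ℂ) (l : ℂ) : Prop :=
  (A - l • B).rank < normalRank A B

end ZGV

namespace ZGV

open Matrix Polynomial

/-! Write Q(x) = x² L₂ + x L₁ + L₀. Read as matrix equations, the kernel of Δ₁ - x Δ₀ splits into
blocks: Q Y Mᵀ = M Y Qᵀ, Q Z Mᵀ - M Z Qᵀ = M Y Q'ᵀ, and two copies of M P L₂ᵀ = L₂ P Mᵀ
(`pencil_mulVec_eq_zero_iff_blocks`). The choice P = M⁻¹ works for every x, so the pencil is
singular.

For the rank drop, compare the kernel with its subspace Y = 0, the kernel of `reducedMap`. At x = i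
k the inclusion is strict: Y = u uᵀ, Z = u u'ᵀ is a solution (`ker_reducedMap_lt_kernelBlocks`). At
x = i r with r real and large it is an equality (`exists_kernelBlocks_le`): Q(i r) is Hermitian, so
after normalising M to the identity Y X'ᵀ is a commutator orthogonal to its kernel, where X' is the
normalised derivative; the leading term r² L₂ then forces Y = 0. Since the subspace Y = 0 has
dimension at most its value at i k for all but finitely many x (`finite_lt_finrank_ker`), some i r
has a smaller kernel than i k. -/

/-- Off a finite set of parameters, the kernel of a quadratic family of endomorphisms is no larger
than at a given parameter. -/
theorem finite_lt_finrank_ker {V : Type*} [AddCommGroup V] [Module ℂ V] [FiniteDimensional ℂ V]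
    (f₀ f₁ f₂ : V →ₗ[ℂ] V) (a : ℂ) :
    {x : ℂ | Module.finrank ℂ (LinearMap.ker (f₀ + a • f₁ + a ^ 2 • f₂)) <
      Module.finrank ℂ (LinearMap.ker (f₀ + x • f₁ + x ^ 2 • f₂))}.Finite := by
  set f : ℂ → V →ₗ[ℂ] V := fun x => f₀ + x • f₁ + x ^ 2 • f₂ with hf
  obtain ⟨C, hC⟩ := Submodule.exists_isCompl (LinearMap.ker (f a))
  obtain ⟨D, hD⟩ := Submodule.exists_isCompl (LinearMap.range (f a))
  have hdim : Module.finrank ℂ (LinearMap.ker (f a)) = Module.finrank ℂ D := by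
    have h1 := LinearMap.finrank_range_add_finrank_ker (f a)
    have h2 := Submodule.finrank_add_eq_of_isCompl hD
    omega
  -- `g` carries the kernel of `f a` onto a complement of its range, so `f a + g` is invertible and
  -- det (`f x + g`) is a nonzero polynomial in `x`.
  let e : LinearMap.ker (f a) ≃ₗ[ℂ] D := LinearEquiv.ofFinrankEq _ _ hdim
  let π := Submodule.projectionOnto _ C hC
  let g : V →ₗ[ℂ] V := D.subtype ∘ₗ e.toLinearMap ∘ₗ π
  have hg : ∀ v, g v = 0 → π v = 0 := by
    intro v hv
    have : e (π v) = 0 := Subtype.ext hv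
    simpa using this
  have hinj : Function.Injective (f a + g) := by
    rw [← LinearMap.ker_eq_bot, LinearMap.ker_eq_bot']
    intro v hv
    have h1 : f a v = -g v := eq_neg_of_add_eq_zero_left hv
    have h2 : f a v ∈ LinearMap.range (f a) ⊓ D :=
      ⟨⟨v, rfl⟩, by rw [h1]; exact D.neg_mem (e (π v)).2⟩
    rw [hD.inf_eq_bot, Submodule.mem_bot] at h2
    have h3 : π v = 0 := hg v (by rw [h2] at h1; simpa using h1.symm)
    have h4 := Submodule.projectionOnto_apply_left hC ⟨v, h2⟩
    exact congrArg Subtype.val (h4.symm.trans h3)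
  let b := Module.finBasis ℂ V
  let mat : (V →ₗ[ℂ] V) → Matrix _ _ ℂ := LinearMap.toMatrix b b
  let P : Matrix (Fin (Module.finrank ℂ V)) (Fin (Module.finrank ℂ V)) ℂ[X] :=
    (mat (f₀ + g)).map Polynomial.C + (Polynomial.X : ℂ[X]) • (mat f₁).map Polynomial.C
      + (Polynomial.X : ℂ[X]) ^ 2 • (mat f₂).map Polynomial.C
  have hP : ∀ x, P.det.eval x = LinearMap.det (f x + g) := by
    intro x
    rw [← LinearMap.det_toMatrix b, ← coe_evalRingHom, RingHom.map_det]
    congr 1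
    ext i j
    simp [P, mat, hf]
    ring
  have hP0 : P.det ≠ 0 := by
    intro h
    have := hP a
    rw [h, eval_zero] at this
    exact (LinearMap.isUnit_det _ ((Module.End.isUnit_iff _).2
      ⟨hinj, LinearMap.injective_iff_surjective.1 hinj⟩)).ne_zero this.symm
  refine (P.det.roots.toFinset.finite_toSet).subset ?_
  intro x hx
  simp only [Set.mem_ofPred_eq] at hx
  by_contra hroot
  have hx0 : LinearMap.det (f x + g) ≠ 0 := by
    rw [← hP x]
    simpa [hP0] using hroot
  -- Where `f x + g` is injective, `π` is injective on the kernel of `f x`, since `g` vanishes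
  -- wherever `π` does.
  refine absurd hx (not_lt.2 ?_)
  refine LinearMap.finrank_le_finrank_of_injective
    (f := π ∘ₗ (LinearMap.ker (f x)).subtype) ?_
  rw [← LinearMap.ker_eq_bot, LinearMap.ker_eq_bot']
  rintro ⟨v, hv⟩ h
  have h1 : (f x + g) v = 0 := by
    have h2 : π v = 0 := h
    have h3 : f x v = 0 := hv
    simp [g, h2, h3]
  have h4 : LinearMap.ker (f x + g) = ⊥ := by
    by_contra hne
    exact hx0 (LinearMap.det_eq_zero_iff_ker_ne_bot.2 hne)
  exact Subtype.ext ((LinearMap.ker_eq_bot'.1 h4) v h1)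

/-! ### Frobenius estimate for Hermitian families -/

section Frobenius

attribute [local instance] Matrix.frobeniusNormedRing Matrix.frobeniusNormedAlgebra

theorem trace_conjTranspose_mul_self_eq_norm_sq {m : Type*} [Fintype m] [DecidableEq m]
    (A : Matrix m m ℂ) : (Aᴴ * A).trace = ((‖A‖ ^ 2 : ℝ) : ℂ) := by
  have h : ‖A‖ ^ 2 = ∑ i, ∑ j, ‖A i j‖ ^ 2 := by
    rw [frobenius_norm_def, ← Real.sqrt_eq_rpow, Real.sq_sqrt (by positivity)]
    simp
  rw [h, Finset.sum_comm]
  simp [Matrix.trace, Matrix.mul_apply, ← Complex.conj_mul']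

/-- If `a` is orthogonal to `2 a - b` for the Frobenius inner product, then `2 ‖a‖ ≤ ‖b‖`. -/
theorem two_mul_norm_le_of_trace_eq_zero {m : Type*} [Fintype m] [DecidableEq m]
    (a b : Matrix m m ℂ) (h : (aᴴ * ((2 : ℂ) • a - b)).trace = 0) : 2 * ‖a‖ ≤ ‖b‖ := by
  have h' := congrArg star h
  rw [← Matrix.trace_conjTranspose] at h'
  have e : (b - (2 : ℂ) • a)ᴴ * (b - (2 : ℂ) • a) = bᴴ * b - (4 : ℂ) • (aᴴ * a)
      + (2 : ℂ) • (aᴴ * ((2 : ℂ) • a - b)) + (2 : ℂ) • (aᴴ * ((2 : ℂ) • a - b))ᴴ := by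
    simp only [conjTranspose_sub, conjTranspose_smul, conjTranspose_mul, conjTranspose_conjTranspose,
      sub_mul, mul_sub, smul_mul_assoc, mul_smul_comm, smul_smul, smul_sub]
    simp only [Complex.star_def, map_ofNat]
    module
  have e' := congrArg Matrix.trace e
  simp only [trace_add, trace_sub, trace_smul, h, h', trace_conjTranspose_mul_self_eq_norm_sq] at e'
  have e'' : ‖b - (2 : ℂ) • a‖ ^ 2 = ‖b‖ ^ 2 - 4 * ‖a‖ ^ 2 := by
    have := congrArg Complex.re e'
    simpa [← Complex.ofReal_pow] using this
  have := sq_nonneg ‖b - (2 : ℂ) • a‖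
  exact le_of_abs_le (abs_le_of_sq_le_sq (by nlinarith) (norm_nonneg _))

/-- For Hermitian `H` the map Z ↦ H Z - Z Hᵀ is self-adjoint for the Frobenius inner product, so its
range is orthogonal to its kernel. -/
theorem trace_conjTranspose_mul_commutator {m : Type*} [Fintype m] {H a Z : Matrix m m ℂ}
    (hH : Hᴴ = H) (ha : H * a = a * Hᵀ) : (aᴴ * (H * Z - Z * Hᵀ)).trace = 0 := by
  have h : aᴴ * H = Hᵀ * aᴴ := by
    have := congrArg conjTranspose ha
    rwa [conjTranspose_mul, conjTranspose_mul, hH, show Hᵀᴴ = Hᴴᵀ from rfl, hH] at this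
  rw [mul_sub, trace_sub, ← mul_assoc, h, mul_assoc, trace_mul_comm, mul_assoc, sub_self]

/-- Far out on the imaginary axis, a Hermitian quadratic family with invertible leading coefficient
admits no nontrivial commuting `Y` whose product with the derivative is a commutator. -/
theorem exists_forall_eq_zero_of_commutator {m : Type*} [Fintype m] [DecidableEq m]
    (G₀ G₁ G₂ : Matrix m m ℂ) (h₀ : G₀ᴴ = G₀) (h₁ : G₁ᴴ = -G₁) (h₂ : G₂ᴴ = G₂)
    (hu : IsUnit G₂.det) :
    ∃ K : ℝ, ∀ k : ℝ, K < k → ∀ Y Z H : Matrix m m ℂ,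
      H = (Complex.I * k) ^ 2 • G₂ + (Complex.I * k) • G₁ + G₀ →
      H * Y = Y * Hᵀ →
      H * Z - Z * Hᵀ = Y * ((2 * (Complex.I * k)) • G₂ + G₁)ᵀ → Y = 0 := by
  refine ⟨1 + 2 * ‖(G₂ᵀ)⁻¹‖ * (‖G₁ᵀ‖ + ‖G₀ᵀ‖), fun k hk Y Z H hH hY hZ => ?_⟩
  set c := ‖(G₂ᵀ)⁻¹‖
  have hc : 0 ≤ c := norm_nonneg _
  have hg1 : 0 ≤ ‖G₁ᵀ‖ := norm_nonneg _
  have hg0 : 0 ≤ ‖G₀ᵀ‖ := norm_nonneg _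
  have hk1 : 1 < k := lt_of_le_of_lt (by nlinarith [mul_nonneg hc (add_nonneg hg1 hg0)]) hk
  have hHH : Hᴴ = H := by
    rw [hH]
    simp [conjTranspose_smul, h₀, h₁, h₂]
  -- With x = i k, x (2 x G₂ + G₁) = 2 H - (x G₁ + 2 G₀), so x times the right-hand side of the
  -- commutator equation is 2 a - b. Here `a` grows like k² and `b` only like k, while orthogonality
  -- gives 2‖a‖ ≤ ‖b‖.
  set a := Y * Hᵀ with ha
  set b := Y * ((Complex.I * k) • G₁ + (2 : ℂ) • G₀)ᵀ with hb
  have hab : (2 : ℂ) • a - b = (Complex.I * k) • (H * Z - Z * Hᵀ) := by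
    rw [hZ, ha, hb, hH]
    simp only [transpose_add, transpose_smul, mul_add, mul_smul_comm]
    module
  have hHa : H * a = a * Hᵀ := by rw [ha, ← mul_assoc, hY]
  have hab2 : 2 * ‖a‖ ≤ ‖b‖ := by
    apply two_mul_norm_le_of_trace_eq_zero
    rw [hab, mul_smul_comm, trace_smul, trace_conjTranspose_mul_commutator hHH hHa, smul_zero]
  have hIk : ‖Complex.I * (k : ℂ)‖ = k := by
    simp [abs_of_pos (zero_lt_one.trans hk1)]
  have hbn : ‖b‖ ≤ ‖Y‖ * (k * ‖G₁ᵀ‖ + 2 * ‖G₀ᵀ‖) := by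
    refine (norm_mul_le _ _).trans (mul_le_mul_of_nonneg_left ?_ (norm_nonneg _))
    rw [transpose_add, transpose_smul, transpose_smul]
    refine (norm_add_le _ _).trans (le_of_eq ?_)
    rw [norm_smul, norm_smul, hIk]
    simp
  have hrest : ‖Y * ((Complex.I * k) • G₁ + G₀)ᵀ‖ ≤ ‖Y‖ * (k * ‖G₁ᵀ‖ + ‖G₀ᵀ‖) := by
    refine (norm_mul_le _ _).trans (mul_le_mul_of_nonneg_left ?_ (norm_nonneg _))
    rw [transpose_add, transpose_smul]
    refine (norm_add_le _ _).trans (le_of_eq ?_)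
    rw [norm_smul, hIk]
  have hlead : k ^ 2 * ‖Y * G₂ᵀ‖ ≤ ‖a‖ + ‖Y * ((Complex.I * k) • G₁ + G₀)ᵀ‖ := by
    have : (Complex.I * k) ^ 2 • (Y * G₂ᵀ) = a - Y * ((Complex.I * k) • G₁ + G₀)ᵀ := by
      rw [ha, hH]
      simp only [transpose_add, transpose_smul, mul_add, mul_smul_comm]
      module
    have h := congrArg norm this
    rw [norm_smul, norm_pow, hIk] at h
    rw [h]
    exact norm_sub_le _ _
  have hYn : ‖Y‖ ≤ ‖Y * G₂ᵀ‖ * c := by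
    have : Y = Y * G₂ᵀ * (G₂ᵀ)⁻¹ := by
      rw [mul_assoc, mul_nonsing_inv _ (by rwa [det_transpose]), mul_one]
    calc ‖Y‖ = ‖Y * G₂ᵀ * (G₂ᵀ)⁻¹‖ := by rw [← this]
      _ ≤ _ := norm_mul_le _ _
  by_contra hne
  have hpos : 0 < ‖Y‖ := norm_pos_iff.2 hne
  -- The bound k > 1 lets the constant `G₀` terms be absorbed into multiples of k.
  have h1 : k ^ 2 * ‖Y * G₂ᵀ‖ ≤ ‖Y‖ * (2 * k * (‖G₁ᵀ‖ + ‖G₀ᵀ‖)) := by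
    have : ‖Y‖ * (2 * k * (‖G₁ᵀ‖ + ‖G₀ᵀ‖)) - (‖Y‖ * (k * ‖G₁ᵀ‖ + 2 * ‖G₀ᵀ‖)) / 2
        - ‖Y‖ * (k * ‖G₁ᵀ‖ + ‖G₀ᵀ‖)
        = ‖Y‖ * (k * ‖G₁ᵀ‖ / 2 + 2 * ((k - 1) * ‖G₀ᵀ‖)) := by ring
    have h2 : 0 ≤ ‖Y‖ * (k * ‖G₁ᵀ‖ / 2 + 2 * ((k - 1) * ‖G₀ᵀ‖)) := by
      have : 0 ≤ k - 1 := by linarith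
      positivity
    linarith
  have h3 : k ^ 2 * ‖Y‖ ≤ k * (‖Y‖ * (2 * c * (‖G₁ᵀ‖ + ‖G₀ᵀ‖))) := by
    calc k ^ 2 * ‖Y‖ ≤ k ^ 2 * (‖Y * G₂ᵀ‖ * c) := by gcongr
      _ = (k ^ 2 * ‖Y * G₂ᵀ‖) * c := by ring
      _ ≤ (‖Y‖ * (2 * k * (‖G₁ᵀ‖ + ‖G₀ᵀ‖))) * c := by gcongr
      _ = _ := by ring
  have h4 : k * ‖Y‖ * (k - 2 * c * (‖G₁ᵀ‖ + ‖G₀ᵀ‖)) ≤ 0 := by linarith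
  have h5 : 0 < k * ‖Y‖ * (k - 2 * c * (‖G₁ᵀ‖ + ‖G₀ᵀ‖)) :=
    mul_pos (mul_pos (by linarith) hpos) (by linarith)
  linarith

end Frobenius

/-! ### Complexification of real matrices -/

theorem cx_kronecker {p q : Type*} (A : Matrix p p ℝ) (B : Matrix q q ℝ) :
    cx (A ⊗ₖ B) = cx A ⊗ₖ cx B := by
  ext i j
  simp [cx]

theorem cx_add {p : Type*} (A B : Matrix p p ℝ) : cx (A + B) = cx A + cx B := by
  ext i j
  simp [cx]

theorem cx_sub {p : Type*} (A B : Matrix p p ℝ) : cx (A - B) = cx A - cx B := by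
  ext i j
  simp [cx]

theorem cx_neg {p : Type*} (A : Matrix p p ℝ) : cx (-A) = -cx A := by
  ext i j
  simp [cx]

theorem cx_mul {p : Type*} [Fintype p] (A B : Matrix p p ℝ) : cx (A * B) = cx A * cx B := by
  ext i j
  simp [cx, Matrix.mul_apply]

theorem cx_one {p : Type*} [DecidableEq p] : cx (1 : Matrix p p ℝ) = 1 := by
  ext i j
  by_cases h : i = j <;> simp [cx, Matrix.one_apply, h]

theorem cx_transpose {p : Type*} (A : Matrix p p ℝ) : cx Aᵀ = (cx A)ᵀ := rfl

theorem cx_conjTranspose {p : Type*} (A : Matrix p p ℝ) : (cx A)ᴴ = cx Aᵀ := by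
  ext i j
  simp [cx]

theorem cx_fromBlocks {p : Type*} (A B C D : Matrix p p ℝ) :
    cx (fromBlocks A B C D) = fromBlocks (cx A) (cx B) (cx C) (cx D) :=
  fromBlocks_map _ _ _ _ _

theorem cx_zero {p : Type*} : cx (0 : Matrix p p ℝ) = 0 := by
  ext i j
  simp [cx]

theorem cx_two_smul {p : Type*} (A : Matrix p p ℝ) : cx ((2 : ℝ) • A) = (2 : ℂ) • cx A := by
  ext i j
  simp [cx]

theorem isUnit_det_cx {p : Type*} [Fintype p] [DecidableEq p] {A : Matrix p p ℝ}
    (h : IsUnit A.det) : IsUnit (cx A).det := by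
  have : (cx A).det = Complex.ofRealHom A.det := (RingHom.map_det Complex.ofRealHom A).symm
  rw [this]
  exact h.map _

/-! ### The pencil as a system of Sylvester equations -/

/-- The slice of a vector on a triple product along its last index. -/
def slice {p q r : Type*} (z : p × q × r → ℂ) (c : r) : Matrix p q ℂ :=
  Matrix.of fun i s => z (i, s, c)

theorem slice_kronecker_mulVec {p q r : Type*} [Fintype p] [Fintype q] [Fintype r]
    (A : Matrix p p ℂ) (B : Matrix q q ℂ) (D : Matrix r r ℂ) (z : p × q × r → ℂ) (c : r) :
    slice ((A ⊗ₖ (B ⊗ₖ D)) *ᵥ z) c = ∑ d, D c d • (A * slice z d * Bᵀ) := by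
  ext i s
  simp only [slice, Matrix.of_apply, mulVec, dotProduct, kroneckerMap_apply, Matrix.sum_apply,
    Matrix.smul_apply, Matrix.mul_apply, transpose_apply, Fintype.sum_prod_type, smul_eq_mul,
    Finset.mul_sum, Finset.sum_mul]
  conv_rhs => rw [Finset.sum_comm]
  rw [Finset.sum_comm]
  refine Finset.sum_congr rfl fun _ _ => ?_
  conv_rhs => rw [Finset.sum_comm]
  refine Finset.sum_congr rfl fun _ _ => Finset.sum_congr rfl fun _ _ => ?_
  ring

theorem eq_zero_iff_slice {p q : Type*} (z : p × q × Fin 2 → ℂ) :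
    z = 0 ↔ slice z 0 = 0 ∧ slice z 1 = 0 := by
  constructor
  · rintro rfl
    exact ⟨rfl, rfl⟩
  · rintro ⟨h0, h1⟩
    funext ⟨i, s, c⟩
    fin_cases c
    · exact congrFun (congrFun h0 i) s
    · exact congrFun (congrFun h1 i) s

/-- The linear map `X ↦ A X Bᵀ - B X Aᵀ`. -/
def sylvester {p : Type*} [Fintype p] (A B : Matrix p p ℂ) :
    Matrix p p ℂ →ₗ[ℂ] Matrix p p ℂ where
  toFun X := A * X * Bᵀ - B * X * Aᵀ
  map_add' X Y := by simp only [mul_add, add_mul]; abel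
  map_smul' c X := by simp [smul_sub]

theorem sylvester_apply {p : Type*} [Fintype p] (A B X : Matrix p p ℂ) :
    sylvester A B X = A * X * Bᵀ - B * X * Aᵀ := rfl

variable {n : ℕ}

/-- The quadratic matrix polynomial `x² L₂ + x L₁ + L₀`. -/
noncomputable def quad (L₀ L₁ L₂ : Matrix (Fin n) (Fin n) ℝ) (x : ℂ) : Matrix (Fin n) (Fin n) ℂ :=
  x ^ 2 • cx L₂ + x • cx L₁ + cx L₀

/-- The derivative `2 x L₂ + L₁` of `quad`. -/
noncomputable def quadDeriv (L₁ L₂ : Matrix (Fin n) (Fin n) ℝ) (x : ℂ) :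
    Matrix (Fin n) (Fin n) ℂ :=
  (2 * x) • cx L₂ + cx L₁

theorem quad_tilde (L₀ L₁ L₂ : Matrix (Fin n) (Fin n) ℝ) (x : ℂ) :
    x ^ 2 • cx (tildeL₂ L₂) + x • cx (tildeL₁ L₁ L₂) + cx (tildeL₀ L₀ L₁) =
      fromBlocks (quad L₀ L₁ L₂ x) 0 (quadDeriv L₁ L₂ x) (quad L₀ L₁ L₂ x) := by
  simp only [tildeL₂, tildeL₁, tildeL₀, cx_fromBlocks, cx_zero, cx_two_smul, fromBlocks_smul,
    fromBlocks_add, quad, quadDeriv]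
  congr 1 <;> module

/-- Slice 1 of the product is the second expression, and slice 0 is minus the first minus x times
the second. The combination x z₀ - z₁ appears because x² C₂ + x C₁ + C₀ has rank one, with kernel
spanned by (1, x). -/
theorem pencil_mulVec_eq_zero_iff (L₀ L₁ L₂ M : Matrix (Fin n) (Fin n) ℝ) (x : ℂ)
    (z : Fin n × (Fin n ⊕ Fin n) × Fin 2 → ℂ) :
    (cx (Δ₁ L₀ L₁ L₂ M) - x • cx (Δ₀ L₁ L₂ M)) *ᵥ z = 0 ↔
      quad L₀ L₁ L₂ x * slice z 0 * (cx (tildeM M))ᵀ - cx M * slice z 0 *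
        (x ^ 2 • cx (tildeL₂ L₂) + x • cx (tildeL₁ L₁ L₂) + cx (tildeL₀ L₀ L₁))ᵀ = 0 ∧
      cx M * (x • slice z 0 - slice z 1) * (cx (tildeL₂ L₂))ᵀ -
        cx L₂ * (x • slice z 0 - slice z 1) * (cx (tildeM M))ᵀ = 0 := by
  have hs : ∀ (a b : Fin n × (Fin n ⊕ Fin n) × Fin 2 → ℂ) (c : Fin 2),
      slice (a - b) c = slice a c - slice b c := fun _ _ _ => rfl
  have ha : ∀ (a b : Fin n × (Fin n ⊕ Fin n) × Fin 2 → ℂ) (c : Fin 2),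
      slice (a + b) c = slice a c + slice b c := fun _ _ _ => rfl
  have hm : ∀ (y : ℂ) (b : Fin n × (Fin n ⊕ Fin n) × Fin 2 → ℂ) (c : Fin 2),
      slice (y • b) c = y • slice b c := fun _ _ _ => rfl
  have h0 : ∀ c, slice (0 : Fin n × (Fin n ⊕ Fin n) × Fin 2 → ℂ) c = 0 := fun _ => rfl
  have hn : ∀ (b : Fin n × (Fin n ⊕ Fin n) × Fin 2 → ℂ) (c : Fin 2),
      slice (-b) c = -slice b c := fun _ _ => rfl
  have e0 : slice ((cx (Δ₁ L₀ L₁ L₂ M) - x • cx (Δ₀ L₁ L₂ M)) *ᵥ z) 1 =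
      cx M * (x • slice z 0 - slice z 1) * (cx (tildeL₂ L₂))ᵀ -
        cx L₂ * (x • slice z 0 - slice z 1) * (cx (tildeM M))ᵀ := by
    simp only [Δ₁, Δ₀, opDet, cx_neg, cx_sub, cx_add, cx_kronecker, cx_zero, kronecker_zero,
      neg_mulVec, sub_mulVec, add_mulVec, smul_mulVec, hs, ha, hm, hn, slice_kronecker_mulVec,
      Fin.sum_univ_two]
    simp [C₀, C₁, C₂, cx, h0, Matrix.mul_sub, Matrix.sub_mul]
    module
  have e1 : slice ((cx (Δ₁ L₀ L₁ L₂ M) - x • cx (Δ₀ L₁ L₂ M)) *ᵥ z) 0 =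
      -(quad L₀ L₁ L₂ x * slice z 0 * (cx (tildeM M))ᵀ - cx M * slice z 0 *
        (x ^ 2 • cx (tildeL₂ L₂) + x • cx (tildeL₁ L₁ L₂) + cx (tildeL₀ L₀ L₁))ᵀ)
      - x • (cx M * (x • slice z 0 - slice z 1) * (cx (tildeL₂ L₂))ᵀ -
        cx L₂ * (x • slice z 0 - slice z 1) * (cx (tildeM M))ᵀ) := by
    simp only [Δ₁, Δ₀, opDet, cx_neg, cx_sub, cx_add, cx_kronecker, cx_zero, kronecker_zero,
      neg_mulVec, sub_mulVec, add_mulVec, smul_mulVec, hs, ha, hm, hn, slice_kronecker_mulVec,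
      Fin.sum_univ_two, quad]
    simp [C₀, C₁, C₂, cx, h0, Matrix.mul_sub, Matrix.sub_mul, Matrix.mul_add, Matrix.add_mul, smul_sub, smul_add]
    module
  rw [eq_zero_iff_slice, e0, e1]
  constructor
  · rintro ⟨h1, h2⟩
    refine ⟨?_, h2⟩
    rw [h2, smul_zero, sub_zero] at h1
    exact neg_eq_zero.1 h1
  · rintro ⟨h1, h2⟩
    rw [h1, h2]
    simp

/-- The four `n × n` blocks `(Y₀, Z₀, x Y₀ - Y₁, x Z₀ - Z₁)` of a vector of size `n · 2n · 2`. -/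
noncomputable def blocks (x : ℂ) : (Fin n × (Fin n ⊕ Fin n) × Fin 2 → ℂ) ≃ₗ[ℂ]
    Matrix (Fin n) (Fin n) ℂ × Matrix (Fin n) (Fin n) ℂ × Matrix (Fin n) (Fin n) ℂ ×
      Matrix (Fin n) (Fin n) ℂ where
  toFun z := (of fun i j => z (i, Sum.inl j, 0), of fun i j => z (i, Sum.inr j, 0),
    of fun i j => x * z (i, Sum.inl j, 0) - z (i, Sum.inl j, 1),
    of fun i j => x * z (i, Sum.inr j, 0) - z (i, Sum.inr j, 1))
  map_add' z w := by
    refine Prod.ext ?_ (Prod.ext ?_ (Prod.ext ?_ ?_)) <;> ext i j <;> simp <;> ring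
  map_smul' c z := by
    refine Prod.ext ?_ (Prod.ext ?_ (Prod.ext ?_ ?_)) <;> ext i j <;> simp <;> ring
  invFun t := fun p => Sum.elim
    (fun j => ![t.1 p.1 j, x * t.1 p.1 j - t.2.2.1 p.1 j] p.2.2)
    (fun j => ![t.2.1 p.1 j, x * t.2.1 p.1 j - t.2.2.2 p.1 j] p.2.2) p.2.1
  left_inv z := by
    funext ⟨i, s, c⟩
    fin_cases c <;> cases s <;> simp
  right_inv t := by
    refine Prod.ext ?_ (Prod.ext ?_ (Prod.ext ?_ ?_)) <;> ext i j <;> simp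

theorem slice_zero_eq_fromCols (x : ℂ) (z : Fin n × (Fin n ⊕ Fin n) × Fin 2 → ℂ) :
    slice z 0 = fromCols (blocks x z).1 (blocks x z).2.1 := by
  ext i (j | j) <;> rfl

theorem smul_slice_sub_eq_fromCols (x : ℂ) (z : Fin n × (Fin n ⊕ Fin n) × Fin 2 → ℂ) :
    x • slice z 0 - slice z 1 = fromCols (blocks x z).2.2.1 (blocks x z).2.2.2 := by
  ext i (j | j) <;> rfl

theorem fromCols_sub_eq_zero_iff {m p q : Type*} (A C : Matrix m p ℂ) (B D : Matrix m q ℂ) :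
    fromCols A B - fromCols C D = 0 ↔ A - C = 0 ∧ B - D = 0 := by
  rw [sub_eq_zero, sub_eq_zero, sub_eq_zero, fromCols_inj.eq_iff]

theorem pencil_mulVec_eq_zero_iff_blocks (L₀ L₁ L₂ M : Matrix (Fin n) (Fin n) ℝ) (x : ℂ)
    (z : Fin n × (Fin n ⊕ Fin n) × Fin 2 → ℂ) :
    (cx (Δ₁ L₀ L₁ L₂ M) - x • cx (Δ₀ L₁ L₂ M)) *ᵥ z = 0 ↔
      sylvester (quad L₀ L₁ L₂ x) (cx M) (blocks x z).1 = 0 ∧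
      sylvester (quad L₀ L₁ L₂ x) (cx M) (blocks x z).2.1 =
        cx M * (blocks x z).1 * (quadDeriv L₁ L₂ x)ᵀ ∧
      sylvester (cx M) (cx L₂) (blocks x z).2.2.1 = 0 ∧
      sylvester (cx M) (cx L₂) (blocks x z).2.2.2 = 0 := by
  rw [pencil_mulVec_eq_zero_iff, quad_tilde, smul_slice_sub_eq_fromCols,
    slice_zero_eq_fromCols x, tildeL₂, tildeM]
  simp only [cx_fromBlocks, cx_zero, fromBlocks_transpose, mul_fromCols, fromCols_mul_fromBlocks,
    fromCols_sub_eq_zero_iff, transpose_zero, Matrix.mul_zero, add_zero, zero_add, sylvester_apply,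
    and_assoc]
  rw [sub_add_eq_sub_sub_swap, sub_eq_zero (b := cx M * (blocks x z).1 * (quadDeriv L₁ L₂ x)ᵀ)]

/-! ### Kernel dimensions and the subspace Y = 0 -/

/-- The map whose kernel consists of the blocks of kernel vectors of the pencil with vanishing first
block. -/
noncomputable def reducedMap (L₀ L₁ L₂ M : Matrix (Fin n) (Fin n) ℝ) (x : ℂ) :
    (Matrix (Fin n) (Fin n) ℂ × Matrix (Fin n) (Fin n) ℂ × Matrix (Fin n) (Fin n) ℂ ×
      Matrix (Fin n) (Fin n) ℂ) →ₗ[ℂ]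
    (Matrix (Fin n) (Fin n) ℂ × Matrix (Fin n) (Fin n) ℂ × Matrix (Fin n) (Fin n) ℂ ×
      Matrix (Fin n) (Fin n) ℂ) :=
  LinearMap.prodMap LinearMap.id (LinearMap.prodMap (sylvester (quad L₀ L₁ L₂ x) (cx M))
    (LinearMap.prodMap (sylvester (cx M) (cx L₂)) (sylvester (cx M) (cx L₂))))

theorem mem_ker_reducedMap (L₀ L₁ L₂ M : Matrix (Fin n) (Fin n) ℝ) (x : ℂ)
    (t : Matrix (Fin n) (Fin n) ℂ × Matrix (Fin n) (Fin n) ℂ × Matrix (Fin n) (Fin n) ℂ ×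
      Matrix (Fin n) (Fin n) ℂ) :
    t ∈ LinearMap.ker (reducedMap L₀ L₁ L₂ M x) ↔ t.1 = 0 ∧
      sylvester (quad L₀ L₁ L₂ x) (cx M) t.2.1 = 0 ∧
      sylvester (cx M) (cx L₂) t.2.2.1 = 0 ∧ sylvester (cx M) (cx L₂) t.2.2.2 = 0 := by
  rw [LinearMap.mem_ker]
  simp [reducedMap, Prod.ext_iff]

/-- Exhibits the quadratic dependence on x that `finite_lt_finrank_ker` requires. -/
theorem reducedMap_eq (L₀ L₁ L₂ M : Matrix (Fin n) (Fin n) ℝ) (x : ℂ) :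
    reducedMap L₀ L₁ L₂ M x = reducedMap L₀ L₁ L₂ M 0 +
      x • LinearMap.prodMap 0 (LinearMap.prodMap (sylvester (cx L₁) (cx M)) 0) +
      x ^ 2 • LinearMap.prodMap 0 (LinearMap.prodMap (sylvester (cx L₂) (cx M)) 0) := by
  refine LinearMap.ext fun t => ?_
  refine Prod.ext ?_ (Prod.ext ?_ (Prod.ext ?_ ?_))
  · simp [reducedMap]
  · simp only [reducedMap, sylvester_apply, quad, LinearMap.prodMap_apply, LinearMap.add_apply,
      LinearMap.smul_apply, Prod.fst_add, Prod.snd_add, Prod.smul_snd, Prod.smul_fst,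
      transpose_add, transpose_smul, mul_add, add_mul, smul_mul_assoc, mul_smul_comm]
    module
  · simp [reducedMap]
  · simp [reducedMap]

/-- The blocks of the kernel vectors of the pencil. -/
noncomputable def kernelBlocks (L₀ L₁ L₂ M : Matrix (Fin n) (Fin n) ℝ) (x : ℂ) :
    Submodule ℂ (Matrix (Fin n) (Fin n) ℂ × Matrix (Fin n) (Fin n) ℂ ×
      Matrix (Fin n) (Fin n) ℂ × Matrix (Fin n) (Fin n) ℂ) :=
  (LinearMap.ker (cx (Δ₁ L₀ L₁ L₂ M) - x • cx (Δ₀ L₁ L₂ M)).mulVecLin).map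
    (blocks x).toLinearMap

theorem mem_kernelBlocks (L₀ L₁ L₂ M : Matrix (Fin n) (Fin n) ℝ) (x : ℂ)
    (t : Matrix (Fin n) (Fin n) ℂ × Matrix (Fin n) (Fin n) ℂ × Matrix (Fin n) (Fin n) ℂ ×
      Matrix (Fin n) (Fin n) ℂ) :
    t ∈ kernelBlocks L₀ L₁ L₂ M x ↔
      sylvester (quad L₀ L₁ L₂ x) (cx M) t.1 = 0 ∧
      sylvester (quad L₀ L₁ L₂ x) (cx M) t.2.1 = cx M * t.1 * (quadDeriv L₁ L₂ x)ᵀ ∧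
      sylvester (cx M) (cx L₂) t.2.2.1 = 0 ∧ sylvester (cx M) (cx L₂) t.2.2.2 = 0 := by
  obtain ⟨z, rfl⟩ := (blocks x).surjective t
  rw [← pencil_mulVec_eq_zero_iff_blocks]
  constructor
  · rintro ⟨w, hw, h⟩
    rw [← (blocks x).injective h]
    exact hw
  · intro h
    exact ⟨z, h, rfl⟩

theorem rank_add_finrank_kernelBlocks (L₀ L₁ L₂ M : Matrix (Fin n) (Fin n) ℝ) (x : ℂ) :
    (cx (Δ₁ L₀ L₁ L₂ M) - x • cx (Δ₀ L₁ L₂ M)).rank +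
      Module.finrank ℂ (kernelBlocks L₀ L₁ L₂ M x) =
      Module.finrank ℂ (Fin n × (Fin n ⊕ Fin n) × Fin 2 → ℂ) := by
  have h : Module.finrank ℂ (kernelBlocks L₀ L₁ L₂ M x) = _ :=
    LinearEquiv.finrank_map_eq (blocks x) _
  rw [h]
  exact LinearMap.finrank_range_add_finrank_ker _

theorem finite_lt_finrank_ker_reducedMap (L₀ L₁ L₂ M : Matrix (Fin n) (Fin n) ℝ) (a : ℂ) :
    {x : ℂ | Module.finrank ℂ (LinearMap.ker (reducedMap L₀ L₁ L₂ M a)) <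
      Module.finrank ℂ (LinearMap.ker (reducedMap L₀ L₁ L₂ M x))}.Finite := by
  have := finite_lt_finrank_ker (reducedMap L₀ L₁ L₂ M 0)
    (LinearMap.prodMap 0 (LinearMap.prodMap (sylvester (cx L₁) (cx M)) 0))
    (LinearMap.prodMap 0 (LinearMap.prodMap (sylvester (cx L₂) (cx M)) 0)) a
  rw [← reducedMap_eq] at this
  refine this.subset fun x hx => ?_
  rw [Set.mem_ofPred_eq] at hx ⊢
  rwa [← reducedMap_eq]

/-! ### Singularity, and the kernels at i k and far up the imaginary axis -/

theorem isSingularPencil [NeZero n] (L₀ L₁ L₂ M : Matrix (Fin n) (Fin n) ℝ)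
    (hL₂ : L₂ᵀ = L₂) (hM : Mᵀ = M) (hu : IsUnit M.det) :
    IsSingularPencil (cx (Δ₁ L₀ L₁ L₂ M)) (cx (Δ₀ L₁ L₂ M)) := by
  intro x
  have hu' := isUnit_det_cx hu
  rw [← Matrix.exists_mulVec_eq_zero_iff]
  -- By symmetry of `M` and `L₂`, M M⁻¹ L₂ᵀ = L₂ = L₂ M⁻¹ Mᵀ.
  refine ⟨(blocks x).symm (0, 0, (cx M)⁻¹, 0), ?_, ?_⟩
  · intro h
    rw [LinearEquiv.map_eq_zero_iff] at h
    have h3 : (cx M)⁻¹ = 0 := congrArg (fun t => t.2.2.1) h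
    have h4 := mul_nonsing_inv _ hu'
    rw [h3, mul_zero] at h4
    exact zero_ne_one h4
  · rw [pencil_mulVec_eq_zero_iff_blocks, LinearEquiv.apply_symm_apply]
    refine ⟨by simp, by simp, ?_, by simp⟩
    rw [sylvester_apply, mul_nonsing_inv _ hu', ← cx_transpose, ← cx_transpose, hL₂, hM, mul_assoc,
      nonsing_inv_mul _ hu']
    simp

theorem ker_reducedMap_lt_kernelBlocks (L₀ L₁ L₂ M : Matrix (Fin n) (Fin n) ℝ)
    (hM : Mᵀ = M) {k ω : ℂ} (hsol : IsZGVSolution L₀ L₁ L₂ M k ω) :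
    LinearMap.ker (reducedMap L₀ L₁ L₂ M (Complex.I * k)) <
      kernelBlocks L₀ L₁ L₂ M (Complex.I * k) := by
  obtain ⟨u, u', hu0, hu, hu'⟩ := hsol
  set x := Complex.I * k with hx
  have hMc : (cx M)ᵀ = cx M := by rw [← cx_transpose, hM]
  have h1 : quad L₀ L₁ L₂ x *ᵥ u = -(ω ^ 2 • (cx M *ᵥ u)) := by
    rw [waveguideOp, add_mulVec, smul_mulVec] at hu
    exact eq_neg_of_add_eq_zero_left hu
  have h2 : quadDeriv L₁ L₂ x *ᵥ u + quad L₀ L₁ L₂ x *ᵥ u' = -(ω ^ 2 • (cx M *ᵥ u')) := by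
    rw [exceptionalOp, quad_tilde, tildeM, cx_fromBlocks, add_mulVec, smul_mulVec,
      fromBlocks_mulVec, fromBlocks_mulVec] at hu'
    have h3 := congrArg (fun v => v ∘ Sum.inr) hu'
    refine eq_neg_of_add_eq_zero_left ?_
    funext i
    have h4 := congrFun h3 i
    simpa [cx_zero] using h4
  refine lt_of_le_of_ne ?_ ?_
  · intro t ht
    rw [mem_ker_reducedMap] at ht
    rw [mem_kernelBlocks]
    obtain ⟨ht1, ht2⟩ := ht
    rw [ht1]
    simpa using ht2
  · intro heq
    -- Since Q u = -ω² M u and Q u' = -ω² M u' - Q' u, the ω² terms cancel and M u (Q' u)ᵀ remains.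
    -- The outer products use the plain transpose, so complex k and ω are allowed.
    have hmem : (vecMulVec u u, vecMulVec u u', (0 : Matrix (Fin n) (Fin n) ℂ),
        (0 : Matrix (Fin n) (Fin n) ℂ)) ∈ kernelBlocks L₀ L₁ L₂ M x := by
      rw [mem_kernelBlocks]
      refine ⟨?_, ?_, by simp, by simp⟩
      · simp only [sylvester_apply, mul_vecMulVec, vecMulVec_mul, vecMul_transpose, h1]
        ext i j
        simp [vecMulVec_apply]
      · have h2' : quad L₀ L₁ L₂ x *ᵥ u' =
            -(ω ^ 2 • (cx M *ᵥ u')) - quadDeriv L₁ L₂ x *ᵥ u := by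
          rw [← h2]; abel
        simp only [sylvester_apply, mul_vecMulVec, vecMulVec_mul, vecMul_transpose, h1, h2']
        ext i j
        simp [vecMulVec_apply]
        ring
    rw [← heq, mem_ker_reducedMap] at hmem
    have h0 : vecMulVec u u = 0 := hmem.1
    obtain ⟨i, hi⟩ := Function.ne_iff.1 hu0
    have := congrFun (congrFun h0 i) i
    simp [vecMulVec_apply] at this
    exact hi this

theorem exists_eq_transpose_mul_self {M : Matrix (Fin n) (Fin n) ℝ} (hM : M.PosDef) :
    ∃ B : Matrix (Fin n) (Fin n) ℝ, M = Bᵀ * B := by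
  open scoped MatrixOrder in
  obtain ⟨B, hB⟩ := CStarAlgebra.nonneg_iff_eq_star_mul_self.mp hM.posSemidef.nonneg
  exact ⟨B, by simpa [star_eq_conjTranspose] using hB⟩

/-- For real k the matrix Q(i k) is Hermitian, because `L₁` is skew-symmetric. With M = Bᵀ B and T =
B⁻¹, replacing Q by Tᵀ Q T and Y by B Y Bᵀ turns the Sylvester equations into the commutator
equations of `exists_forall_eq_zero_of_commutator`. -/
theorem exists_kernelBlocks_le (L₀ L₁ L₂ M : Matrix (Fin n) (Fin n) ℝ)
    (hL₀ : L₀ᵀ = L₀) (hL₁ : L₁ᵀ = -L₁) (hL₂ : L₂ᵀ = L₂) (hM : M.PosDef)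
    (hu : IsUnit L₂.det) :
    ∃ K : ℝ, ∀ k : ℝ, K < k → kernelBlocks L₀ L₁ L₂ M (Complex.I * k) ≤
      LinearMap.ker (reducedMap L₀ L₁ L₂ M (Complex.I * k)) := by
  obtain ⟨B, hB⟩ := exists_eq_transpose_mul_self hM
  have hBu : IsUnit B.det := by
    have h := (Matrix.isUnit_iff_isUnit_det M).1 hM.isUnit
    rw [hB, det_mul] at h
    exact isUnit_of_mul_isUnit_right h
  -- `T = B⁻¹` satisfies `Tᵀ M T = 1`
  obtain ⟨T, hBT, hTB⟩ : ∃ T : Matrix (Fin n) (Fin n) ℝ, B * T = 1 ∧ T * B = 1 :=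
    ⟨B⁻¹, mul_nonsing_inv _ hBu, nonsing_inv_mul _ hBu⟩
  have hTu : IsUnit T.det := by
    have := congrArg Matrix.det hTB
    rw [det_mul, det_one] at this
    exact IsUnit.of_mul_eq_one _ this
  have herm : ∀ A : Matrix (Fin n) (Fin n) ℝ,
      ((cx T)ᵀ * cx A * cx T)ᴴ = (cx T)ᵀ * cx Aᵀ * cx T := by
    intro A
    rw [conjTranspose_mul, conjTranspose_mul, cx_conjTranspose, cx_conjTranspose, ← cx_transpose,
      cx_conjTranspose, transpose_transpose, mul_assoc]
  obtain ⟨K, hK⟩ := exists_forall_eq_zero_of_commutator ((cx T)ᵀ * cx L₀ * cx T)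
    ((cx T)ᵀ * cx L₁ * cx T) ((cx T)ᵀ * cx L₂ * cx T) (by rw [herm, hL₀])
    (by rw [herm, hL₁, cx_neg]; simp) (by rw [herm, hL₂])
    (by
      rw [det_mul, det_mul, det_transpose]
      exact ((isUnit_det_cx hTu).mul (isUnit_det_cx hu)).mul (isUnit_det_cx hTu))
  refine ⟨K, fun k hk t ht => ?_⟩
  rw [mem_kernelBlocks] at ht
  rw [mem_ker_reducedMap]
  obtain ⟨h1, h2, h3⟩ := ht
  suffices h0 : t.1 = 0 by
    refine ⟨h0, ?_, h3⟩
    rw [h2, h0]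
    simp
  set x := Complex.I * (k : ℂ) with hx
  have hTB' : cx T * cx B = 1 := by rw [← cx_mul, hTB, cx_one]
  have hBT' : cx B * cx T = 1 := by rw [← cx_mul, hBT, cx_one]
  have hTBt : (cx T)ᵀ * (cx B)ᵀ = 1 := by rw [← transpose_mul, hBT', transpose_one]
  have hBTt : (cx B)ᵀ * (cx T)ᵀ = 1 := by rw [← transpose_mul, hTB', transpose_one]
  have hMc : cx M = (cx B)ᵀ * cx B := by rw [hB, cx_mul, cx_transpose]
  have hMt : (cx M)ᵀ = (cx B)ᵀ * cx B := by rw [hMc, transpose_mul, transpose_transpose]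
  -- conjugation by `T` turns the products with `M` into plain products
  have hl : ∀ A Y : Matrix (Fin n) (Fin n) ℂ, ((cx T)ᵀ * A * cx T) * (cx B * Y * (cx B)ᵀ) =
      (cx T)ᵀ * (A * Y * (cx M)ᵀ) * cx T := by
    intro A Y
    rw [hMt]
    calc _ = (cx T)ᵀ * A * (cx T * cx B) * Y * (cx B)ᵀ := by simp only [mul_assoc]
      _ = (cx T)ᵀ * A * Y * (cx B)ᵀ * (cx B * cx T) := by rw [hTB', hBT']; simp only [mul_one]
      _ = _ := by simp only [mul_assoc]
  have hr : ∀ A Y : Matrix (Fin n) (Fin n) ℂ, (cx B * Y * (cx B)ᵀ) * ((cx T)ᵀ * A * cx T)ᵀ =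
      (cx T)ᵀ * (cx M * Y * Aᵀ) * cx T := by
    intro A Y
    rw [hMc, transpose_mul, transpose_mul, transpose_transpose]
    calc _ = cx B * Y * ((cx B)ᵀ * (cx T)ᵀ) * Aᵀ * cx T := by simp only [mul_assoc]
      _ = ((cx T)ᵀ * (cx B)ᵀ) * cx B * Y * Aᵀ * cx T := by
        rw [hTBt, hBTt]; simp only [one_mul, mul_one]
      _ = _ := by simp only [mul_assoc]
  have hY : cx B * t.1 * (cx B)ᵀ = 0 := by
    refine hK k hk _ (cx B * t.2.1 * (cx B)ᵀ) ((cx T)ᵀ * quad L₀ L₁ L₂ x * cx T) ?_ ?_ ?_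
    · simp only [hx, quad, mul_add, add_mul, smul_mul_assoc, mul_smul_comm]
    · rw [hl, hr, ← sub_eq_zero, ← sub_mul, ← mul_sub, ← sylvester_apply, h1]
      simp
    · have hD : (2 * x) • ((cx T)ᵀ * cx L₂ * cx T) + (cx T)ᵀ * cx L₁ * cx T =
          (cx T)ᵀ * quadDeriv L₁ L₂ x * cx T := by
        simp only [quadDeriv, mul_add, add_mul, smul_mul_assoc, mul_smul_comm]
      rw [hD, hl, hr, hr, ← sub_mul, ← mul_sub, ← sylvester_apply, h2]
  calc t.1 = (cx T * cx B) * t.1 * ((cx B)ᵀ * (cx T)ᵀ) := by rw [hTB', hBTt]; simp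
    _ = cx T * (cx B * t.1 * (cx B)ᵀ) * (cx T)ᵀ := by simp only [mul_assoc]
    _ = 0 := by rw [hY]; simp

end ZGV

theorem theorem1 (n : ℕ) (L₀ L₁ L₂ M : Matrix (Fin n) (Fin n) ℝ)
    (hL₀ : L₀.transpose = L₀) (hL₁ : L₁.transpose = -L₁) (hL₂ : L₂.transpose = L₂)
    (hM : M.PosDef) (hL₂reg : IsUnit L₂.det)
    (k ω : ℂ) (hsol : ZGV.IsZGVSolution L₀ L₁ L₂ M k ω) :
    ZGV.IsSingularPencil (ZGV.cx (ZGV.Δ₁ L₀ L₁ L₂ M)) (ZGV.cx (ZGV.Δ₀ L₁ L₂ M)) ∧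
      ZGV.IsFiniteEigenvalue (ZGV.cx (ZGV.Δ₁ L₀ L₁ L₂ M)) (ZGV.cx (ZGV.Δ₀ L₁ L₂ M))
        (Complex.I * k) := by
  have hMt : M.transpose = M := by simpa using hM.isHermitian.eq
  -- A nonzero `u` rules out n = 0, where M⁻¹ would be zero.
  have hn : NeZero n := ⟨by
    rintro rfl
    obtain ⟨u, -, hu, -⟩ := hsol
    exact hu (Subsingleton.elim _ _)⟩
  refine ⟨ZGV.isSingularPencil L₀ L₁ L₂ M hL₂ hMt
    ((Matrix.isUnit_iff_isUnit_det M).1 hM.isUnit), ?_⟩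
  obtain ⟨K, hK⟩ := ZGV.exists_kernelBlocks_le L₀ L₁ L₂ M hL₀ hL₁ hL₂ hM hL₂reg
  have hfin := ZGV.finite_lt_finrank_ker_reducedMap L₀ L₁ L₂ M (Complex.I * k)
  have hinj : Function.Injective fun r : ℝ => Complex.I * (r : ℂ) := fun a b h => by
    simpa using h
  -- Infinitely many r exceed `K`, so some i r avoids the finite exceptional set. There the pencil's
  -- kernel is at most the reduced kernel at i r, hence in dimension at most the one at i k, which
  -- is strictly below the pencil's kernel at i k.
  obtain ⟨r, hr, hr'⟩ := (Set.Ioi_infinite K).exists_notMem_finite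
    (hfin.preimage hinj.injOn)
  rw [Set.mem_preimage, Set.mem_ofPred_eq, not_lt] at hr'
  have h2 := Submodule.finrank_mono (hK r hr)
  have h3 := Submodule.finrank_lt_finrank_of_lt
    (ZGV.ker_reducedMap_lt_kernelBlocks L₀ L₁ L₂ M hMt hsol)
  have h4 := ZGV.rank_add_finrank_kernelBlocks L₀ L₁ L₂ M (Complex.I * k)
  have h5 := ZGV.rank_add_finrank_kernelBlocks L₀ L₁ L₂ M (Complex.I * r)
  have h6 := (ZGV.isGreatest_normalRank (ZGV.cx (ZGV.Δ₁ L₀ L₁ L₂ M))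
    (ZGV.cx (ZGV.Δ₀ L₁ L₂ M))).2 ⟨Complex.I * r, rfl⟩
  simp only at h6
  unfold ZGV.IsFiniteEigenvalue
  omega
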